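/- Regard $\mathbb{Z}^n$ as the graph whose edges are the pairs $\{x,x+e_i\}$ with $x\in\mathbb{Z}^n$ and $1\le i\le n$, where $e_1,\dots,e_n$ is the standard basis. A function $f:\mathbb{Z}^n\to\{0,1\}$ is called $p$-biased if for every vertex $x$ the fraction of the $2n$ neighbours of $x$ on which $f$ takes the value $1$ is exactly $p$. Two such functions $f,g$ are isomorphic if there is a graph automorphism $\varphi$ of $\mathbb{Z}^n$ with $g\circ\varphi=f$. **Theorem 4.1.** For every integer $n>1$ and every $c\in\{1,\dots,2n-1\}$, there are exactly $2^{\aleph_0}$ isomorphism classes of $\frac{c}{2n}$-biased functions $f:\mathbb{Z}^n\to\{0,1\}$. -/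

import Mathlib

open scoped Cardinal

/-- The graph on `ℤ^n` whose edges are the pairs `{x, x + e_i}`. -/
def zGraph (n : ℕ) : SimpleGraph (Fin n → ℤ) where
  Adj x y := ∃ i : Fin n, y = x + Pi.single i 1 ∨ x = y + Pi.single i 1
  symm := ⟨fun _ _ ⟨i, h⟩ => ⟨i, h.symm⟩⟩
  loopless := ⟨by
    rintro x ⟨i, h | h⟩ <;>
    · have h' := congrFun h i
      simp at h'⟩

/-- A 0-1 function `f` on the vertices of `G` is `p`-biased if for each vertex `v` the fraction of
the neighbours of `v` on which `f` takes the value 1 is exactly `p`. -/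
def IsBiased {V : Type*} (G : SimpleGraph V) (p : ℝ) (f : V → Fin 2) : Prop :=
  ∀ v : V, ({w ∈ G.neighborSet v | f w = 1}.ncard : ℝ) / ((G.neighborSet v).ncard : ℝ) = p

/-- The type of `p`-biased 0-1 functions on `G`. -/
abbrev BiasedFunction {V : Type*} (G : SimpleGraph V) (p : ℝ) : Type _ :=
  {f : V → Fin 2 // IsBiased G p f}

/-- Two biased functions are isomorphic if some automorphism of the graph carries one to the
other. -/
def biasedSetoid {V : Type*} (G : SimpleGraph V) (p : ℝ) : Setoid (BiasedFunction G p) where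
  r f g := ∃ φ : G ≃g G, ∀ v : V, g.1 (φ v) = f.1 v
  iseqv :=
    { refl := fun _ => ⟨RelIso.refl _, fun _ => rfl⟩
      symm := fun {f g} ⟨φ, h⟩ => ⟨φ.symm, fun v => by
        rw [← h (φ.symm v), RelIso.apply_symm_apply]⟩
      trans := fun {f g k} ⟨φ, h⟩ ⟨ψ, h'⟩ => ⟨φ.trans ψ, fun v => by
        rw [RelIso.trans_apply, h', h]⟩ }

/-! There are at most `2 ^ ℵ₀` functions in all. An automorphism is determined by its values at `0`
and the `e_i` (`zGraph_iso_ext`), so classes are countable and continuum many biased functions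
suffice. To build them, note that `x` has `n` neighbours on each adjacent level of the coordinate
sum, and on each of these levels `∑ i * x_i` mod `n` takes every residue once. Selecting `m s`
residues on level `s` thus gives `m (s + 1) + m (s - 1)` ones around a vertex of level `s`, however
the selections are shifted (`isBiased_levelFunction`). The shifts are free and encode a binary
sequence. -/

/-! ### Automorphisms of the lattice graph -/

/-- The vectors `e_i` and `-e_i`. -/
def IsSignedUnit {n : ℕ} (a : Fin n → ℤ) : Prop :=
  ∃ i : Fin n, a = Pi.single i 1 ∨ a = -Pi.single i 1

namespace IsSignedUnit

variable {n : ℕ} {a b s t : Fin n → ℤ}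

lemma apply_trichotomy (h : IsSignedUnit a) (j : Fin n) :
    a j = 0 ∨ (a j = 1 ∧ a = Pi.single j 1) ∨ (a j = -1 ∧ a = -Pi.single j 1) := by
  obtain ⟨i, rfl | rfl⟩ := h <;> by_cases hij : j = i
  · subst hij; simp
  · simp [hij]
  · subst hij; simp
  · simp [hij]

/-- Look at the coordinate supporting `a`: its entry is either cancelled by `s` or matched by `t`,
since `b ≠ a`. -/
lemma eq_or_eq_neg_of_add_eq (ha : IsSignedUnit a) (hb : IsSignedUnit b) (hs : IsSignedUnit s)
    (ht : IsSignedUnit t) (hab : a ≠ b) (h : a + s = b + t) : s = b ∨ s = -a := by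
  by_contra! hne
  have hta : t ≠ a := by
    rintro rfl
    exact hne.1 (by rw [add_comm b] at h; exact add_left_cancel h)
  obtain ⟨hsb, hsa⟩ := hne
  obtain ⟨i, hi⟩ := ha
  have hc := congrFun h i
  simp only [Pi.add_apply] at hc
  have h1 := hs.apply_trichotomy i
  have h2 := hb.apply_trichotomy i
  have h3 := ht.apply_trichotomy i
  rcases hi with rfl | rfl
  · simp only [Pi.single_eq_same] at hc
    rcases h1 with h1 | ⟨h1, e1⟩ | ⟨h1, e1⟩
    · rcases h2 with h2 | ⟨h2, e2⟩ | ⟨h2, e2⟩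
      · rcases h3 with h3 | ⟨h3, e3⟩ | ⟨h3, e3⟩
        · omega
        · exact hta e3
        · omega
      · exact hab e2.symm
      · rcases h3 with h3 | ⟨h3, e3⟩ | ⟨h3, e3⟩ <;> omega
    · rcases h2 with h2 | ⟨h2, e2⟩ | ⟨h2, e2⟩
      · rcases h3 with h3 | ⟨h3, e3⟩ | ⟨h3, e3⟩ <;> omega
      · exact hab e2.symm
      · rcases h3 with h3 | ⟨h3, e3⟩ | ⟨h3, e3⟩ <;> omega
    · exact hsa e1
  · simp only [Pi.neg_apply, Pi.single_eq_same] at hc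
    rcases h1 with h1 | ⟨h1, e1⟩ | ⟨h1, e1⟩
    · rcases h2 with h2 | ⟨h2, e2⟩ | ⟨h2, e2⟩
      · rcases h3 with h3 | ⟨h3, e3⟩ | ⟨h3, e3⟩
        · omega
        · omega
        · exact hta e3
      · rcases h3 with h3 | ⟨h3, e3⟩ | ⟨h3, e3⟩ <;> omega
      · exact hab e2.symm
    · exact hsa (by rw [e1, neg_neg])
    · rcases h2 with h2 | ⟨h2, e2⟩ | ⟨h2, e2⟩
      · rcases h3 with h3 | ⟨h3, e3⟩ | ⟨h3, e3⟩ <;> omega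
      · rcases h3 with h3 | ⟨h3, e3⟩ | ⟨h3, e3⟩ <;> omega
      · exact hab e2.symm

end IsSignedUnit

lemma zGraph_adj_iff {n : ℕ} {x y : Fin n → ℤ} :
    (zGraph n).Adj x y ↔ IsSignedUnit (y - x) := by
  refine exists_congr fun i => or_congr ?_ ?_
  · rw [sub_eq_iff_eq_add']
  · rw [sub_eq_iff_eq_add', ← sub_eq_add_neg, eq_sub_iff_add_eq, eq_comm]

lemma zGraph_adj_add {n : ℕ} {x a : Fin n → ℤ} (ha : IsSignedUnit a) :
    (zGraph n).Adj x (x + a) := by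
  rwa [zGraph_adj_iff, add_sub_cancel_left]

/-- The common neighbours of two distinct neighbours `p + a`, `p + b` of `p` are `p` and
`p + a + b`. -/
lemma zGraph_common_neighbor {n : ℕ} {p a b w : Fin n → ℤ} (ha : IsSignedUnit a)
    (hb : IsSignedUnit b) (hab : a ≠ b) (h₁ : (zGraph n).Adj (p + a) w)
    (h₂ : (zGraph n).Adj (p + b) w) : w = p ∨ w = p + a + b := by
  rw [zGraph_adj_iff] at h₁ h₂
  rcases ha.eq_or_eq_neg_of_add_eq hb h₁ h₂ hab (by abel) with h | h
  · right; rw [← h]; abel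
  · left; rw [sub_eq_iff_eq_add] at h; rw [h]; abel

lemma zGraph_iso_parallelogram {n : ℕ} (φ : zGraph n ≃g zGraph n) (x : Fin n → ℤ)
    {u v : Fin n → ℤ} (hu : IsSignedUnit u) (hv : IsSignedUnit v) (huv : u ≠ v) :
    φ (x + u + v) = φ (x + u) + φ (x + v) - φ x := by
  obtain ⟨a, ha⟩ : ∃ a, φ (x + u) = φ x + a := ⟨_, (add_sub_cancel _ _).symm⟩
  obtain ⟨b, hb⟩ : ∃ b, φ (x + v) = φ x + b := ⟨_, (add_sub_cancel _ _).symm⟩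
  have ua : IsSignedUnit a := by
    have := φ.map_adj_iff.2 (zGraph_adj_add (x := x) hu)
    rwa [ha, zGraph_adj_iff, add_sub_cancel_left] at this
  have ub : IsSignedUnit b := by
    have := φ.map_adj_iff.2 (zGraph_adj_add (x := x) hv)
    rwa [hb, zGraph_adj_iff, add_sub_cancel_left] at this
  have hab : a ≠ b := by
    rintro rfl
    exact huv (add_left_cancel (φ.injective (ha.trans hb.symm)))
  have key : φ (x + u + v) = φ x ∨ φ (x + u + v) = φ x + a + b := by
    refine zGraph_common_neighbor ua ub hab ?_ ?_
    · rw [← ha]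
      exact φ.map_adj_iff.2 (zGraph_adj_add hv)
    · rw [← hb, add_right_comm]
      exact φ.map_adj_iff.2 (zGraph_adj_add hu)
  -- Pulling back the desired value also covers `v = -u`, where the two candidates for the common
  -- neighbour may coincide.
  obtain ⟨w, hw⟩ := φ.surjective (φ x + a + b)
  have key' : w = x ∨ w = x + u + v := by
    refine zGraph_common_neighbor hu hv huv ?_ ?_
    · rw [← φ.map_adj_iff, ha, hw]
      exact zGraph_adj_add ub
    · rw [← φ.map_adj_iff, hb, hw, add_right_comm]
      exact zGraph_adj_add ua
  have goal : φ (x + u + v) = φ x + a + b := by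
    rcases key with h | h
    · rcases key' with rfl | rfl
      · exact h.trans hw
      · exact hw
    · exact h
  rw [goal, ha, hb]
  abel

/-- By the parallelogram rule the increment along `e_i` is invariant under each translation `e_j`;
the periods form a subgroup, hence are everything. -/
lemma zGraph_iso_add_single {n : ℕ} (φ : zGraph n ≃g zGraph n) (i : Fin n) (x : Fin n → ℤ) :
    φ (x + Pi.single i 1) - φ x = φ (Pi.single i 1) - φ 0 := by
  have up : ∀ (j : Fin n) (x : Fin n → ℤ),
      φ (x + Pi.single j 1 + Pi.single i 1) - φ (x + Pi.single j 1) =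
        φ (x + Pi.single i 1) - φ x := by
    intro j x
    by_cases hij : j = i
    · subst hij
      have hne : (Pi.single j 1 : Fin n → ℤ) ≠ -Pi.single j 1 := by
        intro h
        have := congrFun h j
        simp at this
      -- Along a straight line, use the degenerate parallelogram centred at the midpoint.
      have h := zGraph_iso_parallelogram φ (x + Pi.single j 1) ⟨j, Or.inl rfl⟩ ⟨j, Or.inr rfl⟩ hne
      simp only [add_neg_cancel_right] at h
      linear_combination -h
    · have hne : (Pi.single j 1 : Fin n → ℤ) ≠ Pi.single i 1 := by
        intro h
        have := congrFun h j
        simp [hij] at this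
      rw [zGraph_iso_parallelogram φ x ⟨j, Or.inl rfl⟩ ⟨i, Or.inl rfl⟩ hne]
      abel
  let S : AddSubgroup (Fin n → ℤ) :=
    { carrier := {w | ∀ x, φ (x + w + Pi.single i 1) - φ (x + w) = φ (x + Pi.single i 1) - φ x}
      zero_mem' := fun x => by simp
      add_mem' := fun {v w} hv hw x => by
        rw [← add_assoc, hw, hv]
      neg_mem' := fun {w} hw x => by
        rw [← hw (x + -w), neg_add_cancel_right] }
  have hS : x ∈ S := by
    rw [pi_eq_sum_univ' x]
    refine sum_mem fun j _ => ?_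
    refine S.zsmul_mem (x := Pi.single j 1) ?_ (x j)
    exact up j
  simpa using hS 0

lemma zGraph_iso_ext {n : ℕ} {φ ψ : zGraph n ≃g zGraph n} (h₀ : φ 0 = ψ 0)
    (h : ∀ i, φ (Pi.single i 1) = ψ (Pi.single i 1)) : φ = ψ := by
  let S : AddSubgroup (Fin n → ℤ) :=
    { carrier := {w | ∀ x, φ (x + w) - φ x = ψ (x + w) - ψ x}
      zero_mem' := fun x => by simp
      add_mem' := fun {v w} hv hw x => by
        have h₁ := hv x
        have h₂ := hw (x + v)
        rw [← add_assoc, ← sub_add_sub_cancel _ (φ (x + v)), h₁, h₂, sub_add_sub_cancel]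
      neg_mem' := fun {w} hw x => by
        have := hw (x + -w)
        rw [neg_add_cancel_right] at this
        rw [← neg_sub, this, neg_sub] }
  refine RelIso.ext fun x => ?_
  have hS : x ∈ S := by
    rw [pi_eq_sum_univ' x]
    refine sum_mem fun j _ => ?_
    refine S.zsmul_mem (x := Pi.single j 1) ?_ (x j)
    intro y
    rw [zGraph_iso_add_single, zGraph_iso_add_single, h, h₀]
  have := hS 0
  rwa [zero_add, h₀, sub_left_inj] at this

instance countable_zGraph_iso (n : ℕ) : Countable (zGraph n ≃g zGraph n) := by
  refine Function.Injective.countable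
    (f := fun φ : zGraph n ≃g zGraph n => (φ 0, fun i => φ (Pi.single i 1))) fun φ ψ h => ?_
  exact zGraph_iso_ext (congrArg Prod.fst h) (congrFun (congrArg Prod.snd h))

/-! ### Counting isomorphism classes -/

/-- A function is recovered from its class and an automorphism to the chosen representative. -/
lemma mk_biasedFunction_le {V : Type*} (G : SimpleGraph V) [Countable (G ≃g G)] (p : ℝ) :
    #(BiasedFunction G p) ≤ #(Quotient (biasedSetoid G p)) * ℵ₀ := by
  have ex : ∀ f : BiasedFunction G p, ∃ φ : G ≃g G,
      ∀ v, (Quotient.mk (biasedSetoid G p) f).out.1 (φ v) = f.1 v := fun f =>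
    (biasedSetoid G p).symm (Quotient.mk_out (s := biasedSetoid G p) f)
  choose φ hφ using ex
  have inj : Function.Injective
      fun f : BiasedFunction G p => (Quotient.mk (biasedSetoid G p) f, φ f) := by
    intro f g h
    obtain ⟨h₁, h₂⟩ := Prod.mk.inj h
    refine Subtype.ext (funext fun v => ?_)
    rw [← hφ f, ← hφ g, h₁, h₂]
  calc #(BiasedFunction G p) ≤ #(Quotient (biasedSetoid G p) × (G ≃g G)) :=
        Cardinal.mk_le_of_injective inj
    _ = #(Quotient (biasedSetoid G p)) * #(G ≃g G) := by rw [Cardinal.mul_def]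
    _ ≤ _ := mul_le_mul_right (Cardinal.mk_le_aleph0) _

/-- If a countable graph has countably many automorphisms and continuum many `p`-biased functions,
then it has continuum many isomorphism classes of them. -/
lemma mk_quotient_biasedSetoid {V : Type} [Countable V] (G : SimpleGraph V) [Countable (G ≃g G)]
    (p : ℝ) {F : (ℕ → Bool) → BiasedFunction G p} (hF : Function.Injective F) :
    #(Quotient (biasedSetoid G p)) = 2 ^ ℵ₀ := by
  apply le_antisymm
  · calc #(Quotient (biasedSetoid G p)) ≤ #(BiasedFunction G p) := Cardinal.mk_quotient_le
      _ ≤ #(V → Fin 2) := Cardinal.mk_subtype_le _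
      _ = 2 ^ #V := by simp
      _ ≤ 2 ^ ℵ₀ := Cardinal.power_le_power_left two_ne_zero Cardinal.mk_le_aleph0
  · have h : (2 : Cardinal) ^ ℵ₀ ≤ #(Quotient (biasedSetoid G p)) * ℵ₀ := by
      calc (2 : Cardinal) ^ ℵ₀ = #(ℕ → Bool) := by simp
        _ ≤ #(BiasedFunction G p) := Cardinal.mk_le_of_injective hF
        _ ≤ _ := mk_biasedFunction_le G p
    by_contra! hlt
    have hmax := h.trans (Cardinal.mul_le_max _ _)
    have : (2 : Cardinal) ^ ℵ₀ ≤ ℵ₀ := by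
      rcases le_max_iff.1 hmax with h' | h'
      · rcases le_max_iff.1 h' with h'' | h''
        · exact absurd h'' hlt.not_ge
        · exact h''
      · exact h'
    exact absurd this (Cardinal.cantor ℵ₀).not_ge

/-! ### Biased functions that are balanced on each level -/

lemma ncard_zGraph_neighborSet_sep {n : ℕ} (v : Fin n → ℤ) (P : (Fin n → ℤ) → Prop)
    [DecidablePred P] :
    {w ∈ (zGraph n).neighborSet v | P w}.ncard =
      (Finset.univ.filter fun i => P (v + Pi.single i 1)).card +
        (Finset.univ.filter fun i => P (v - Pi.single i 1)).card := by
  have hunion : {w ∈ (zGraph n).neighborSet v | P w} =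
      (fun i => v + Pi.single i 1) '' {i | P (v + Pi.single i 1)} ∪
        (fun i => v - Pi.single i 1) '' {i | P (v - Pi.single i 1)} := by
    ext w
    simp only [SimpleGraph.mem_neighborSet, Set.mem_ofPred_eq, Set.mem_union, Set.mem_image]
    constructor
    · rintro ⟨⟨i, rfl | h⟩, hP⟩
      · exact Or.inl ⟨i, hP, rfl⟩
      · obtain rfl : v - Pi.single i 1 = w := by rw [h, add_sub_cancel_right]
        exact Or.inr ⟨i, hP, rfl⟩
    · rintro (⟨i, hP, rfl⟩ | ⟨i, hP, rfl⟩)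
      · exact ⟨⟨i, Or.inl rfl⟩, hP⟩
      · exact ⟨⟨i, Or.inr (by rw [sub_add_cancel])⟩, hP⟩
  have hinj : Function.Injective fun i : Fin n => (Pi.single i 1 : Fin n → ℤ) := by
    intro i j h
    by_contra hij
    have := congrFun h i
    simp [hij] at this
  rw [hunion, Set.ncard_union_eq, Set.ncard_image_of_injective, Set.ncard_image_of_injective]
  · simp only [← Set.ncard_coe_finset, Finset.coe_filter, Finset.mem_univ, true_and]
  · exact fun i j h => hinj (sub_right_injective h)
  · exact fun i j h => hinj (add_left_cancel h)
  · rw [Set.disjoint_left]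
    rintro _ ⟨i, -, rfl⟩ ⟨j, -, h⟩
    have := congrFun h i
    simp only [Pi.sub_apply, Pi.add_apply, Pi.single_eq_same, Pi.single_apply] at this
    split_ifs at this <;> omega

lemma ncard_zGraph_neighborSet {n : ℕ} (v : Fin n → ℤ) :
    ((zGraph n).neighborSet v).ncard = 2 * n := by
  have := ncard_zGraph_neighborSet_sep v fun _ => True
  simpa only [and_true, Set.ofPred_mem_eq, Finset.filter_true, Finset.card_univ,
    Fintype.card_fin, ← two_mul] using this

lemma card_filter_zmod_val_lt {n : ℕ} [NeZero n] {m : ℕ} (hm : m ≤ n) :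
    (Finset.univ.filter fun z : ZMod n => z.val < m).card = m := by
  rw [← Finset.card_range m]
  refine Finset.card_bij' (fun z _ => z.val) (fun k _ => (k : ZMod n)) ?_ ?_ ?_ ?_
  · intro z hz; simpa using hz
  · intro k hk
    have hk := Finset.mem_range.1 hk
    simpa [ZMod.val_natCast_of_lt (hk.trans_le hm)] using hk
  · intro z _; simp
  · intro k hk
    exact ZMod.val_natCast_of_lt ((Finset.mem_range.1 hk).trans_le hm)

lemma bijective_fin_cast_zmod (n : ℕ) [NeZero n] :
    Function.Bijective fun i : Fin n => ((i : ℕ) : ZMod n) := by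
  rw [Fintype.bijective_iff_injective_and_card]
  refine ⟨fun i j h => Fin.ext ?_, by simp [ZMod.card]⟩
  have := congrArg ZMod.val h
  rwa [ZMod.val_natCast_of_lt i.2, ZMod.val_natCast_of_lt j.2] at this

/-- The sum of the coordinates. -/
def level {n : ℕ} (x : Fin n → ℤ) : ℤ := ∑ i, x i

/-- The residue of `∑ i * x_i` modulo `n`. -/
def residue {n : ℕ} (x : Fin n → ℤ) : ZMod n := ∑ i : Fin n, (x i : ZMod n) * ((i : ℕ) : ZMod n)

lemma level_add {n : ℕ} (x y : Fin n → ℤ) : level (x + y) = level x + level y := by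
  simp [level, Finset.sum_add_distrib]

lemma level_sub {n : ℕ} (x y : Fin n → ℤ) : level (x - y) = level x - level y := by
  simp [level, Finset.sum_sub_distrib]

lemma level_single {n : ℕ} (i : Fin n) (k : ℤ) : level (Pi.single i k) = k := by
  simp [level]

lemma residue_add {n : ℕ} (x y : Fin n → ℤ) : residue (x + y) = residue x + residue y := by
  simp [residue, Finset.sum_add_distrib, add_mul]

lemma residue_sub {n : ℕ} (x y : Fin n → ℤ) : residue (x - y) = residue x - residue y := by
  simp [residue, Finset.sum_sub_distrib, sub_mul]

lemma residue_single {n : ℕ} (i : Fin n) (k : ℤ) :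
    residue (Pi.single i k) = (k : ZMod n) * ((i : ℕ) : ZMod n) := by
  rw [residue, Finset.sum_eq_single i]
  · simp
  · intro j _ hj; simp [hj]
  · simp

/-- The function which on level `s` is the indicator of `m s` consecutive residues modulo `n`,
shifted by `a s`. -/
def levelFunction {n : ℕ} (m : ℤ → ℕ) (a : ℤ → ZMod n) (x : Fin n → ℤ) : Fin 2 :=
  if (residue x + a (level x)).val < m (level x) then 1 else 0

lemma levelFunction_eq_one {n : ℕ} {m : ℤ → ℕ} {a : ℤ → ZMod n} {x : Fin n → ℤ} :
    levelFunction m a x = 1 ↔ (residue x + a (level x)).val < m (level x) := by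
  simp [levelFunction]

lemma isBiased_levelFunction {n c : ℕ} [NeZero n] {m : ℤ → ℕ} (a : ℤ → ZMod n)
    (hm : ∀ s, m s ≤ n) (hc : ∀ s, m (s + 1) + m (s - 1) = c) :
    IsBiased (zGraph n) ((c : ℝ) / (2 * (n : ℝ))) (levelFunction m a) := by
  intro v
  have hb := bijective_fin_cast_zmod n
  have hup : (Finset.univ.filter fun i => levelFunction m a (v + Pi.single i 1) = 1).card =
      m (level v + 1) := by
    simp only [levelFunction_eq_one, level_add, level_single, residue_add, residue_single,
      Int.cast_one, one_mul]
    refine Eq.trans ?_ (card_filter_zmod_val_lt (hm (level v + 1)))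
    refine Finset.card_bijective
      (fun i : Fin n => residue v + ((i : ℕ) : ZMod n) + a (level v + 1)) ?_ (by simp)
    exact (((Equiv.addLeft (residue v)).trans (Equiv.addRight (a (level v + 1)))).bijective).comp hb
  have hdown : (Finset.univ.filter fun i => levelFunction m a (v - Pi.single i 1) = 1).card =
      m (level v - 1) := by
    simp only [levelFunction_eq_one, level_sub, level_single, residue_sub, residue_single,
      Int.cast_one, one_mul]
    refine Eq.trans ?_ (card_filter_zmod_val_lt (hm (level v - 1)))
    refine Finset.card_bijective
      (fun i : Fin n => residue v - ((i : ℕ) : ZMod n) + a (level v - 1)) ?_ (by simp)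
    exact (((Equiv.subLeft (residue v)).trans (Equiv.addRight (a (level v - 1)))).bijective).comp hb
  rw [ncard_zGraph_neighborSet_sep, ncard_zGraph_neighborSet, hup, hdown, hc]
  push_cast
  rfl

lemma exists_injective_biasedFunction {n c : ℕ} (hn : 1 < n) (hc : 1 ≤ c) (hc' : c ≤ 2 * n - 1) :
    ∃ F : (ℕ → Bool) → BiasedFunction (zGraph n) ((c : ℝ) / (2 * (n : ℝ))),
      Function.Injective F := by
  have : NeZero n := ⟨by omega⟩
  -- `0 < k < n` makes the window of `k` residues contain `0` but not `-1`, so shifts are visible.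
  obtain ⟨k, hk₀, hkn, hkc, hck⟩ : ∃ k, 0 < k ∧ k < n ∧ k ≤ c ∧ c - k ≤ n := by
    by_cases h : c = 1
    · exact ⟨1, by omega⟩
    · exact ⟨c / 2, by omega⟩
  -- Levels two apart always carry one `k` and one `c - k`.
  let m : ℤ → ℕ := fun s => if s % 4 < 2 then k else c - k
  -- The bit `b j` is read off at `4j * e_0`, of level `4j` and residue `0`. Negative levels reuse
  -- `b 0`, harmlessly.
  let a : (ℕ → Bool) → ℤ → ZMod n := fun b s => if b (s / 4).toNat then 0 else -1
  have hm : ∀ s, m s ≤ n := fun s => by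
    simp only [m]; split_ifs <;> omega
  have hmc : ∀ s, m (s + 1) + m (s - 1) = c := fun s => by
    simp only [m]; split_ifs <;> omega
  refine ⟨fun b => ⟨levelFunction m (a b), isBiased_levelFunction _ hm hmc⟩, fun b b' h => ?_⟩
  have hval : ∀ (b : ℕ → Bool) (j : ℕ),
      levelFunction m (a b) (Pi.single (0 : Fin n) (4 * (j : ℤ))) = 1 ↔ b j = true := by
    intro b j
    have hj : (4 * (j : ℤ)) / 4 = j := by omega
    have hneg : ¬ (-1 : ZMod n).val < k := by
      obtain ⟨n, rfl⟩ := Nat.exists_eq_succ_of_ne_zero (NeZero.ne n)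
      rw [ZMod.val_neg_one]
      omega
    rw [levelFunction_eq_one, level_single, residue_single]
    cases hb : b j <;> simp [m, a, hj, hb, hk₀, hneg]
  funext j
  have hf := congrFun (congrArg Subtype.val h) (Pi.single (0 : Fin n) (4 * (j : ℤ)))
  dsimp only at hf
  exact Bool.eq_iff_iff.2 (by rw [← hval b, ← hval b', hf])

theorem theorem4p1 (n : ℕ) (hn : 1 < n) (c : ℕ) (hc : 1 ≤ c) (hc' : c ≤ 2 * n - 1) :
    #(Quotient (biasedSetoid (zGraph n) ((c : ℝ) / (2 * (n : ℝ))))) = 2 ^ ℵ₀ := by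
  obtain ⟨F, hF⟩ := exists_injective_biasedFunction hn hc hc'
  exact mk_quotient_biasedSetoid _ _ hF
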